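/- **Theorem.** Let $k,N\ge 1$ be integers and let $X_1,\dots,X_k$ be finite sets of cardinalities $n_1,\dots,n_k$, with indices read modulo $k$ (so $X_{k+1}=X_1$, $n_0=n_k$) and treated as pairwise disjoint. Let $x_v$ be commuting variables indexed by $v\in X_1\sqcup\cdots\sqcup X_k$. For a $k$-tuple $f=(f_1,\dots,f_k)$ of functions $f_i:X_i\to X_{i+1}$ put $$w(f)=\prod_{i=1}^k\prod_{v\in X_i}x_{f_i(v)}\in\mathbb Z[x_v].$$ Call $f$ *eventually $N$-cyclic* if the iterated images $(f_k\cdots f_1)^m(X_1)$ of the composition $f_k\cdots f_1:X_1\to X_1$ eventually stabilize to a set of cardinality $N$ on which $f_k\cdots f_1$ acts as an $N$-cycle (a fixed point, if $N=1$). Let $P_N(\mathbf x)=\sum_f w(f)$, summed over all eventually $N$-cyclic $k$-tuples, and let $e_j(X_i)=\sum_{S\subseteq X_i,\,|S|=j}\prod_{v\in S}x_v$. Then, in the field of fractions of $\mathbb Z[x_v]$, $$P_N(\mathbf x)=\frac{(N!)^k}{N}\prod_{i=1}^k e_1(X_i)^{\,n_{i-1}-(N+1)}\left(\prod_{j=1}^k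 e_1(X_j)\,e_N(X_j)-(N+1)^k\prod_{j=1}^k e_{N+1}(X_j)\right).$$ (Exponents may be negative. If some $X_i$ is empty, negative powers of $e_1(X_i)=0$ are read as $0$; both sides are then $0$.) -/

import Mathlib

/-!
Vertex sets are a family `X : ZMod k → Type*` of finite types, so that indices are literally read
modulo `k`: the sets `X_1, …, X_k` are `X 1, …, X k`, and `X k = X 0`.
A `k`-tuple `(f_1, …, f_k)` is a term of `∀ i, X i → X (i + 1)`.
The disjoint union of the vertex sets is the sigma type `Σ i, X i`.
-/

namespace CyclicTuples

variable {k : ℕ} {X : ZMod k → Type*}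

/-- The endomorphism of the disjoint union of the `X i` that acts as `f i` on `X i`. -/
def step (f : ∀ i, X i → X (i + 1)) (u : Σ i, X i) : Σ i, X i :=
  ⟨u.1 + 1, f u.1 u.2⟩

theorem step_iterate_fst (f : ∀ i, X i → X (i + 1)) (m : ℕ) (u : Σ i, X i) :
    ((step f)^[m] u).1 = u.1 + (m : ZMod k) := by
  induction m with
  | zero => simp
  | succ m ih =>
    rw [Function.iterate_succ_apply', step]
    simp [ih, add_assoc]

/-- The composition `f_k ∘ ⋯ ∘ f_1 : X 1 → X 1`: apply `f_1`, then `f_2`, and so on up to `f_k`;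
after `k` steps the index is `1 + k = 1` again. -/
def roundTrip (f : ∀ i, X i → X (i + 1)) (x : X 1) : X 1 :=
  cast (congrArg X ((step_iterate_fst f k ⟨1, x⟩).trans (by simp))) ((step f)^[k] ⟨1, x⟩).2

/-- The defining property of `roundTrip`, without a cast. -/
theorem mk_roundTrip (f : ∀ i, X i → X (i + 1)) (x : X 1) :
    (⟨1, roundTrip f x⟩ : Σ i, X i) = (step f)^[k] ⟨1, x⟩ := by
  have h : ((step f)^[k] ⟨1, x⟩).1 = 1 := (step_iterate_fst f k ⟨1, x⟩).trans (by simp)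
  exact Sigma.ext h.symm (cast_heq _ _)

/-- The self-map `g` acts on the set `U` as an `N`-cycle: `U` has `N` elements and `g` restricts to
a permutation of `U` that consists of a single cycle (a fixed point, if `N = 1`). -/
def ActsAsCycle {α : Type*} (g : α → α) (U : Set α) (N : ℕ) : Prop :=
  U.ncard = N ∧
    ∃ h : Set.BijOn g U U, Equiv.Perm.IsCycleOn (Set.BijOn.equiv g h) Set.univ

/-- The `k`-tuple `f` is eventually `N`-cyclic: the iterated images of the composition
`f_k ∘ ⋯ ∘ f_1 : X 1 → X 1` eventually stabilize to a set of cardinality `N`, on which the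
composition acts as an `N`-cycle. -/
def EventuallyCyclic (N : ℕ) (f : ∀ i, X i → X (i + 1)) : Prop :=
  ∃ U : Set (X 1), (∃ m₀ : ℕ, ∀ m ≥ m₀, Set.range ((roundTrip f)^[m]) = U) ∧
    ActsAsCycle (roundTrip f) U N

variable [NeZero k] [∀ i, Fintype (X i)]

/-- The weight `w(f) = ∏_i ∏_{v ∈ X_i} x_{f_i(v)}` of a `k`-tuple. -/
noncomputable def weight (f : ∀ i, X i → X (i + 1)) : MvPolynomial (Σ i, X i) ℤ :=
  ∏ i, ∏ v : X i, MvPolynomial.X ⟨i + 1, f i v⟩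

variable (X)

open Classical in
/-- The generating polynomial `P_N(x)`: the sum of the weights of all eventually `N`-cyclic
`k`-tuples. -/
noncomputable def genPoly (N : ℕ) : MvPolynomial (Σ i, X i) ℤ :=
  ∑ f : (∀ i, X i → X (i + 1)) with EventuallyCyclic N f, weight f

/-- The elementary symmetric polynomial `e_j(X_i)` in the variables indexed by `X_i`. -/
noncomputable def e (j : ℕ) (i : ZMod k) : MvPolynomial (Σ i, X i) ℤ :=
  MvPolynomial.rename (Sigma.mk i) (MvPolynomial.esymm (X i) ℤ j)

end CyclicTuples

/-! A tuple `f` is the same as the self-map `step f` of the disjoint union, and it is eventually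
N-cyclic exactly when `step f` has a cycle of length kN that attracts every vertex. An enumeration
`b` of this cycle, started at one of its N vertices in `X 1`, amounts to one injection of `Fin N`
into each `X i`. Counting the pairs (f, b) therefore gives N · P_N. Once `b` is fixed, the edges on
the cycle are forced and the others form a forest on the complement, rooted in the cycle
(`natCast_mul_sum_eventuallyCyclic`).

For forests on W rooted in U, let w_i and a_i be the sums of the weights of class i in W and in W ∪
U, and let n_i count class i of W. The weighted count is ∏ a_{i+1}^{n_i} - ∏ w_i · ∏ a_{i+1}^{n_i -
1} (`forestSum_eq`). The proof is by induction on the size of W. Let T be the set of vertices sent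
directly into U; what remains is a forest on W \ T rooted in T, whose count involves only class sums
of W. Summing over T is a binomial expansion, which adds the class sums of U.

If U is the cycle, then a_i = e_1(X_i), and w_i sums the vertices of X_i off the cycle. In the sum
over all injections, the first term yields N! e_N(X_i) for each i. In the second, w_i supplies one
further value of the injection, which yields (N+1)! e_{N+1}(X_i). -/

namespace CyclicTuples

/-! ### Weighted enumeration of rooted forests -/

section Forests

open Finset

variable {V R : Type*} [Fintype V] [DecidableEq V] [CommRing R] {k : ℕ}

/-- The sum of the weights `x v` over the vertices `v ∈ S` of class `i`. -/
def classSum (x : V → R) (c : V → ZMod k) (S : Finset V) (i : ZMod k) : R :=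
  ∑ v ∈ S with c v = i, x v

/-- The maps `T → U` that raise the class by one, extended by the identity. -/
def raisingMaps (c : V → ZMod k) (T U : Finset V) : Finset (V → V) :=
  {h : V → V | (∀ v ∉ T, h v = v) ∧ ∀ v ∈ T, h v ∈ U ∧ c (h v) = c v + 1}

open Classical in
/-- The forests on `W` rooted in `U`: maps `W → W ∪ U` that raise the class by one, extended by
the identity, and under which every vertex eventually leaves `W`. -/
noncomputable def forests (c : V → ZMod k) (W U : Finset V) : Finset (V → V) :=
  {g ∈ raisingMaps c W (W ∪ U) | ∀ v, ∃ m, g^[m] v ∉ W}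

/-- The sum of the weights of the forests on `W` rooted in `U`. -/
noncomputable def forestSum (x : V → R) (c : V → ZMod k) (W U : Finset V) : R :=
  ∑ g ∈ forests c W U, ∏ v ∈ W, x (g v)

variable [NeZero k]

/-- The choices of one vertex of `W` in every class. -/
def transversals (c : V → ZMod k) (W : Finset V) : Finset (ZMod k → V) :=
  Fintype.piFinset fun i => {v ∈ W | c v = i}

omit [NeZero k] in
theorem mem_raisingMaps {c : V → ZMod k} {T U : Finset V} {h : V → V} :
    h ∈ raisingMaps c T U ↔
      (∀ v ∉ T, h v = v) ∧ ∀ v ∈ T, h v ∈ U ∧ c (h v) = c v + 1 := by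
  simp [raisingMaps]

omit [NeZero k] in
theorem mem_forests {c : V → ZMod k} {W U : Finset V} {g : V → V} :
    g ∈ forests c W U ↔ g ∈ raisingMaps c W (W ∪ U) ∧ ∀ v, ∃ m, g^[m] v ∉ W := by
  simp [forests]

omit [Fintype V] [DecidableEq V] in
theorem mem_transversals {c : V → ZMod k} {W : Finset V} {r : ZMod k → V} :
    r ∈ transversals c W ↔ ∀ i, r i ∈ W ∧ c (r i) = i := by
  simp [transversals]

omit [Fintype V] [NeZero k] in
theorem classSum_union (x : V → R) (c : V → ZMod k) {S T : Finset V} (h : Disjoint S T)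
    (i : ZMod k) : classSum x c (S ∪ T) i = classSum x c S i + classSum x c T i := by
  rw [classSum, filter_union, sum_union (disjoint_filter_filter h)]
  rfl

omit [NeZero k] in
theorem prod_classSum_eq_sum_raisingMaps (x : V → R) (c : V → ZMod k) (T U : Finset V) :
    ∏ v ∈ T, classSum x c U (c v + 1) = ∑ h ∈ raisingMaps c T U, ∏ v ∈ T, x (h v) := by
  -- The singleton choices off `T` encode the extension by the identity.
  have key := Finset.prod_univ_sum
    (fun v : V => if v ∈ T then ({u ∈ U | c u = c v + 1} : Finset V) else {v})
    (fun v w => if v ∈ T then x w else 1)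
  have h1 : ∏ v ∈ T, classSum x c U (c v + 1) =
      ∏ v : V, ∑ w ∈ (if v ∈ T then ({u ∈ U | c u = c v + 1} : Finset V) else {v}),
        (if v ∈ T then x w else 1) := by
    rw [← Finset.prod_subset (subset_univ T)]
    · refine prod_congr rfl fun v hv => ?_
      simp [hv, classSum]
    · intro v _ hv
      simp [hv]
  rw [h1, key]
  refine sum_congr ?_ fun h _ => ?_
  · ext h
    rw [mem_raisingMaps, Fintype.mem_piFinset]
    constructor
    · intro H
      refine ⟨fun v hv => by simpa [hv] using H v, fun v hv => by simpa [hv] using H v⟩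
    · intro H v
      by_cases hv : v ∈ T
      · simpa [hv] using H.2 v hv
      · simpa [hv] using H.1 v hv
  · rw [Finset.prod_ite_mem, univ_inter]

omit [Fintype V] [DecidableEq V] in
theorem sum_transversals (x : V → R) (c : V → ZMod k) (W : Finset V) :
    ∑ r ∈ transversals c W, ∏ i, x (r i) = ∏ i, classSum x c W i :=
  (Finset.prod_univ_sum _ _).symm

omit [Fintype V] [DecidableEq V] in
theorem prod_comp_class (c : V → ZMod k) (W : Finset V) (φ : ZMod k → R) :
    ∏ v ∈ W, φ (c v) = ∏ i, φ i ^ #{v ∈ W | c v = i} := by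
  rw [← Finset.prod_fiberwise W c]
  refine prod_congr rfl fun i _ => ?_
  rw [prod_congr rfl (g := fun _ => φ i), prod_const]
  intro v hv
  rw [(mem_filter.1 hv).2]

omit [Fintype V] in
theorem prod_comp_class_sdiff (c : V → ZMod k) (W : Finset V) (φ : ZMod k → R)
    {r : ZMod k → V} (hr : r ∈ transversals c W) :
    ∏ v ∈ W \ univ.image r, φ (c v) = ∏ i, φ i ^ (#{v ∈ W | c v = i} - 1) := by
  rw [mem_transversals] at hr
  rw [prod_comp_class]
  refine prod_congr rfl fun i _ => ?_
  congr 1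
  rw [← Finset.card_erase_of_mem (a := r i) (by simp [hr])]
  congr 1
  ext v
  simp only [mem_filter, mem_sdiff, mem_image, mem_univ, true_and, mem_erase]
  constructor
  · rintro ⟨⟨hv, h⟩, rfl⟩
    exact ⟨fun e => h ⟨_, e.symm⟩, hv, rfl⟩
  · rintro ⟨h, hv, rfl⟩
    refine ⟨⟨hv, ?_⟩, rfl⟩
    rintro ⟨j, rfl⟩
    rw [(hr j).2] at h
    exact h rfl

omit [Fintype V] in
theorem sum_transversals_mul (x : V → R) (c : V → ZMod k) (W : Finset V) (φ : ZMod k → R) :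
    ∑ r ∈ transversals c W, (∏ i, x (r i)) * ∏ v ∈ W \ univ.image r, φ (c v) =
      (∏ i, classSum x c W i) * ∏ i, φ i ^ (#{v ∈ W | c v = i} - 1) := by
  rw [← sum_transversals, sum_mul]
  exact sum_congr rfl fun r hr => by rw [prod_comp_class_sdiff c W φ hr]

-- An orbit leaves `W` only through a vertex of `T`, so the edges out of `T` can be chosen freely in
-- `U`, and the other edges need only lead every vertex of `W \ T` to `T`.
omit [NeZero k] in
theorem forests_fiber {c : V → ZMod k} {W U T : Finset V} (hWU : Disjoint W U) (hT : T ⊆ W)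
    {g : V → V} : (g ∈ forests c W U ∧ {v ∈ W | g v ∈ U} = T) ↔
      (fun v => if v ∈ T then g v else v) ∈ raisingMaps c T U ∧
      (fun v => if v ∈ T then v else g v) ∈ forests c (W \ T) T := by
  set g' : V → V := fun v => if v ∈ T then v else g v with hg'
  have hg'T : ∀ v, v ∉ T → g' v = g v := fun v hv => by simp [hg', hv]
  simp only [mem_forests, mem_raisingMaps, mem_sdiff, mem_union, not_and, not_not]
  constructor
  · rintro ⟨⟨⟨h1, h2⟩, h3⟩, h4⟩
    have hmem : ∀ v, v ∈ T ↔ v ∈ W ∧ g v ∈ U := fun v => by rw [← h4, mem_filter]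
    refine ⟨⟨fun v hv => by simp [hv], fun v hv => ?_⟩, ⟨fun v hv => ?_, ?_⟩, ?_⟩
    · simp only [hv, if_true]
      exact ⟨((hmem v).1 hv).2, (h2 v (hT hv)).2⟩
    · by_cases hvT : v ∈ T
      · simp [hg', hvT]
      · rw [hg'T v hvT]
        exact h1 v fun hvW => hvT (hv hvW)
    · rintro v ⟨hvW, hvT⟩
      rw [hg'T v hvT]
      obtain ⟨h5, h6⟩ := h2 v hvW
      refine ⟨?_, h6⟩
      rcases h5 with h5 | h5
      · by_cases h7 : g v ∈ T
        · exact Or.inr h7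
        · exact Or.inl ⟨h5, h7⟩
      · exact absurd ((hmem v).2 ⟨hvW, h5⟩) hvT
    · have key : ∀ m v, g^[m] v ∉ W → ∃ m', g'^[m'] v ∈ W → g'^[m'] v ∈ T := by
        intro m
        induction m with
        | zero => exact fun v hv => ⟨0, fun h => absurd h hv⟩
        | succ m ih =>
          intro v hv
          by_cases hvT : v ∈ T
          · exact ⟨0, fun _ => hvT⟩
          · rw [Function.iterate_succ_apply, ← hg'T v hvT] at hv
            obtain ⟨m', h⟩ := ih _ hv
            exact ⟨m' + 1, h⟩
      intro v
      obtain ⟨m, hm⟩ := h3 v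
      exact key m v hm
  · rintro ⟨⟨-, h2⟩, ⟨h3, h4⟩, h5⟩
    have h2' : ∀ v ∈ T, g v ∈ U ∧ c (g v) = c v + 1 := fun v hv => by simpa [hv] using h2 v hv
    have h4' : ∀ v ∈ W, v ∉ T → (g v ∈ W ∧ g v ∉ T ∨ g v ∈ T) ∧ c (g v) = c v + 1 :=
      fun v hv hvT => by
        have := h4 v ⟨hv, hvT⟩
        rwa [hg'T v hvT] at this
    refine ⟨⟨⟨fun v hv => ?_, fun v hv => ?_⟩, ?_⟩, ?_⟩
    · rw [← hg'T v fun h => hv (hT h)]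
      exact h3 v fun h => absurd h hv
    · by_cases hvT : v ∈ T
      · exact ⟨Or.inr (h2' v hvT).1, (h2' v hvT).2⟩
      · refine ⟨Or.inl ?_, (h4' v hv hvT).2⟩
        rcases (h4' v hv hvT).1 with h | h
        · exact h.1
        · exact hT h
    · have key : ∀ m v, (g'^[m] v ∈ W → g'^[m] v ∈ T) → ∃ m', g^[m'] v ∉ W := by
        intro m
        induction m with
        | zero =>
          intro v hv
          by_cases hvW : v ∈ W
          · exact ⟨1, fun h => disjoint_left.1 hWU h (h2' v (hv hvW)).1⟩
          · exact ⟨0, hvW⟩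
        | succ m ih =>
          intro v hv
          by_cases hvT : v ∈ T
          · exact ⟨1, fun h => disjoint_left.1 hWU h (h2' v hvT).1⟩
          · rw [Function.iterate_succ_apply, hg'T v hvT] at hv
            obtain ⟨m', h⟩ := ih _ hv
            exact ⟨m' + 1, h⟩
      intro v
      obtain ⟨m, hm⟩ := h5 v
      exact key m v hm
    · ext v
      rw [mem_filter]
      constructor
      · rintro ⟨hv, hvU⟩
        by_contra hvT
        rcases (h4' v hv hvT).1 with h | h
        · exact disjoint_left.1 hWU h.1 hvU
        · exact disjoint_left.1 hWU (hT h) hvU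
      · exact fun hv => ⟨hT hv, (h2' v hv).1⟩

omit [NeZero k] in
theorem forestSum_eq_sum_powerset (x : V → R) (c : V → ZMod k) {W U : Finset V}
    (hWU : Disjoint W U) : forestSum x c W U =
      ∑ T ∈ W.powerset, (∏ v ∈ T, classSum x c U (c v + 1)) * forestSum x c (W \ T) T := by
  rw [forestSum, ← sum_fiberwise_of_maps_to (s := forests c W U) (t := W.powerset)
    (g := fun g => ({v ∈ W | g v ∈ U} : Finset V))
    (fun g _ => mem_powerset.2 (filter_subset _ _))]
  refine sum_congr rfl fun T hT => ?_
  rw [mem_powerset] at hT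
  rw [prod_classSum_eq_sum_raisingMaps, forestSum, sum_mul_sum, ← sum_product']
  refine sum_bij' (fun g _ => (fun v => if v ∈ T then g v else v,
      fun v => if v ∈ T then v else g v)) (fun p _ v => if v ∈ T then p.1 v else p.2 v)
    ?_ ?_ ?_ ?_ ?_
  · intro g hg
    rw [mem_filter] at hg
    exact mem_product.2 ((forests_fiber hWU hT).1 hg)
  · rintro ⟨h, g'⟩ hp
    rw [mem_product] at hp
    rw [mem_filter, forests_fiber hWU hT]
    obtain ⟨hp1, hp2⟩ := hp
    have e1 : (fun v => if v ∈ T then (if v ∈ T then h v else g' v) else v) = h := by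
      funext v
      by_cases hv : v ∈ T
      · simp [hv]
      · simpa only [if_neg hv] using ((mem_raisingMaps.1 hp1).1 v hv).symm
    have e2 : (fun v => if v ∈ T then v else (if v ∈ T then h v else g' v)) = g' := by
      funext v
      by_cases hv : v ∈ T
      · simpa only [if_pos hv] using
          ((mem_raisingMaps.1 (mem_forests.1 hp2).1).1 v (by simp [hv])).symm
      · simp [hv]
    rw [e1, e2]
    exact ⟨hp1, hp2⟩
  · intro g _
    funext v
    by_cases hv : v ∈ T <;> simp [hv]
  · rintro ⟨h, g'⟩ hp
    obtain ⟨hp1, hp2⟩ := mem_product.1 hp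
    refine Prod.ext (funext fun v => ?_) (funext fun v => ?_)
    · by_cases hv : v ∈ T
      · simp [hv]
      · simpa only [if_neg hv] using ((mem_raisingMaps.1 hp1).1 v hv).symm
    · by_cases hv : v ∈ T
      · simpa only [if_pos hv] using
          ((mem_raisingMaps.1 (mem_forests.1 hp2).1).1 v (by simp [hv])).symm
      · simp [hv]
  · intro g _
    rw [← prod_sdiff hT, mul_comm]
    congr 1
    · exact prod_congr rfl fun v hv => by simp [hv]
    · exact prod_congr rfl fun v hv => by simp [(mem_sdiff.1 hv).2]

omit [NeZero k] in
theorem forestSum_empty_left (x : V → R) (c : V → ZMod k) (U : Finset V) :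
    forestSum x c ∅ U = 1 := by
  have : forests c ∅ U = {id} := by
    ext g
    simp [mem_forests, mem_raisingMaps, funext_iff]
  simp [forestSum, this]

omit [NeZero k] in
theorem forestSum_empty_right (x : V → R) (c : V → ZMod k) {W : Finset V} (hW : W.Nonempty) :
    forestSum x c W ∅ = 0 := by
  have : forests c W ∅ = ∅ := by
    rw [eq_empty_iff_forall_notMem]
    intro g hg
    simp only [mem_forests, mem_raisingMaps, union_empty] at hg
    obtain ⟨v, hv⟩ := hW
    obtain ⟨m, hm⟩ := hg.2 v
    refine hm ?_
    clear hm
    induction m with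
    | zero => exact hv
    | succ m ih =>
      rw [Function.iterate_succ_apply']
      exact (hg.1.2 _ ih).1
  simp [forestSum, this]

omit [Fintype V] [DecidableEq V] in
/-- The closed form of `forestSum` vanishes when there are no roots. -/
theorem prod_classSum_eq_of_nonempty (x : V → R) (c : V → ZMod k) {W : Finset V}
    (hW : W.Nonempty) : ∏ v ∈ W, classSum x c W (c v + 1) =
      (∏ i, classSum x c W i) * ∏ i, classSum x c W (i + 1) ^ (#{v ∈ W | c v = i} - 1) := by
  by_cases hall : ∀ i, 0 < #{v ∈ W | c v = i}
  · rw [prod_comp_class c W fun i => classSum x c W (i + 1),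
      ← Equiv.prod_comp (Equiv.addRight (1 : ZMod k)) (fun i => classSum x c W i), ← prod_mul_distrib]
    refine prod_congr rfl fun i _ => ?_
    rw [Equiv.coe_addRight, ← pow_succ', Nat.sub_add_cancel (hall i)]
  · push Not at hall
    obtain ⟨i, hi⟩ := hall
    have hz : ∀ i, #{v ∈ W | c v = i} ≤ 0 → classSum x c W i = 0 := by
      intro i hi
      rw [Nat.le_zero, card_eq_zero] at hi
      rw [classSum, hi, sum_empty]
    rw [prod_eq_zero (mem_univ i) (hz i hi), zero_mul]
    by_contra hne
    -- Emptiness propagates backwards: a vertex of class `i - (m + 1)` would contribute the class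
    -- sum of the empty class `i - m` as a zero factor. Going round `ZMod k` empties all of `W`.
    have hback : ∀ m : ℕ, #{v ∈ W | c v = i - m} ≤ 0 := by
      intro m
      induction m with
      | zero => simpa using hi
      | succ m ih =>
        by_contra hpos
        obtain ⟨v, hv⟩ := card_pos.1 (not_le.1 hpos)
        rw [mem_filter] at hv
        refine hne (prod_eq_zero hv.1 (hz _ ?_))
        rw [hv.2]
        convert ih using 5
        push_cast
        ring
    obtain ⟨v, hv⟩ := hW
    have := hback (i - c v).val
    rw [ZMod.natCast_zmod_val, sub_sub_cancel, Nat.le_zero, card_eq_zero,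
      eq_empty_iff_forall_notMem] at this
    exact this v (by simp [hv])

/-- Summing over all `T ⊆ W` the terms with a transversal that avoids `T`. -/
theorem sum_powerset_transversals (x : V → R) (c : V → ZMod k) (W : Finset V) (a b : V → R) :
    ∑ T ∈ W.powerset, (∏ v ∈ T, a v) * ∑ r ∈ transversals c (W \ T), (∏ i, x (r i)) *
        ∏ v ∈ (W \ T) \ univ.image r, b v =
      ∑ r ∈ transversals c W, (∏ i, x (r i)) * ∏ v ∈ W \ univ.image r, (a v + b v) := by
  simp_rw [mul_sum]
  rw [sum_comm' (t' := transversals c W) (s' := fun r => (W \ univ.image r).powerset)]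
  · refine sum_congr rfl fun r _ => ?_
    rw [prod_add, mul_sum]
    refine sum_congr rfl fun T _ => ?_
    rw [sdiff_right_comm]
    ring
  · intro T r
    simp only [mem_powerset, mem_transversals, mem_sdiff, subset_iff, mem_image, mem_univ,
      true_and]
    constructor
    · rintro ⟨h1, h2⟩
      refine ⟨fun v hv => ⟨h1 hv, ?_⟩, fun i => ⟨(h2 i).1.1, (h2 i).2⟩⟩
      rintro ⟨i, rfl⟩
      exact (h2 i).1.2 hv
    · rintro ⟨h1, h2⟩
      exact ⟨fun v hv => (h1 hv).1, fun i => ⟨⟨(h2 i).1, fun h => (h1 h).2 ⟨i, rfl⟩⟩, (h2 i).2⟩⟩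

/-- With the subtracted term written as a sum over transversals, both terms are sums of products
over vertices, so that the recursion over `T` becomes a binomial expansion. The induction hypothesis
for `W \ T` rooted in `T` only involves class sums of `W`, as the union of these two sets is `W`. -/
theorem forestSum_eq_sub_sum_transversals (x : V → R) (c : V → ZMod k) {W U : Finset V}
    (hWU : Disjoint W U) : forestSum x c W U =
      ∏ v ∈ W, classSum x c (W ∪ U) (c v + 1) -
        ∑ r ∈ transversals c W, (∏ i, x (r i)) *
          ∏ v ∈ W \ univ.image r, classSum x c (W ∪ U) (c v + 1) := by
  induction hn : #W using Nat.strong_induction_on generalizing W U with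
  | _ n ih =>
  -- The term `T = ∅` is out of reach of the induction hypothesis, since `W \ ∅` is not smaller.
  -- There both sides vanish.
  have hempty : ∀ {W : Finset V}, W.Nonempty → forestSum x c W ∅ =
      ∏ v ∈ W, classSum x c (W ∪ ∅) (c v + 1) -
        ∑ r ∈ transversals c W, (∏ i, x (r i)) *
          ∏ v ∈ W \ univ.image r, classSum x c (W ∪ ∅) (c v + 1) := by
    intro W hW
    rw [forestSum_empty_right x c hW, union_empty,
      sum_transversals_mul x c W fun i => classSum x c W (i + 1),
      ← prod_classSum_eq_of_nonempty x c hW, sub_self]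
  rcases W.eq_empty_or_nonempty with rfl | hW
  · have : transversals c (∅ : Finset V) = ∅ := by
      rw [eq_empty_iff_forall_notMem]
      intro r hr
      simpa using (mem_transversals.1 hr 0).1
    simp [forestSum_empty_left, this]
  rw [forestSum_eq_sum_powerset x c hWU]
  have step : ∀ T ∈ W.powerset, forestSum x c (W \ T) T =
      ∏ v ∈ W \ T, classSum x c W (c v + 1) -
        ∑ r ∈ transversals c (W \ T), (∏ i, x (r i)) *
          ∏ v ∈ (W \ T) \ univ.image r, classSum x c W (c v + 1) := by
    intro T hT
    rw [mem_powerset] at hT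
    rcases T.eq_empty_or_nonempty with rfl | hT'
    · simpa using hempty hW
    · have := ih _ (hn ▸ card_lt_card (sdiff_ssubset hT hT')) sdiff_disjoint rfl
      rwa [sdiff_union_of_subset hT] at this
  rw [sum_congr rfl fun T hT => by rw [step T hT, mul_sub], sum_sub_distrib, ← prod_add,
    sum_powerset_transversals]
  simp_rw [classSum_union x c hWU, add_comm (classSum x c U _)]

/-- The weighted count of forests. If class `i` does not meet `W`, then the second term vanishes,
so that the truncated subtraction in the exponent is harmless. -/
theorem forestSum_eq (x : V → R) (c : V → ZMod k) {W U : Finset V} (hWU : Disjoint W U) :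
    forestSum x c W U =
      ∏ i, classSum x c (W ∪ U) (i + 1) ^ #{v ∈ W | c v = i} -
        (∏ i, classSum x c W i) *
          ∏ i, classSum x c (W ∪ U) (i + 1) ^ (#{v ∈ W | c v = i} - 1) := by
  rw [forestSum_eq_sub_sum_transversals x c hWU,
    prod_comp_class c W fun i => classSum x c (W ∪ U) (i + 1),
    sum_transversals_mul x c W fun i => classSum x c (W ∪ U) (i + 1)]

end Forests

/-! ### Eventually cyclic tuples and enumerations of their cycles -/

section Starts

open Function

/-- The points of the only cycle of `h`, provided that this cycle has length `N` and attracts every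
point; otherwise the empty set. -/
def attractingCycle {α : Type*} (h : α → α) (N : ℕ) : Set α :=
  {v | minimalPeriod h v = N ∧ ∀ u, ∃ m, h^[m] u = v}

theorem minimalPeriod_eq_of_forall_dvd {α : Type*} {h : α → α} {v : α} {n : ℕ}
    (H : ∀ t, IsPeriodicPt h t v ↔ n ∣ t) : minimalPeriod h v = n :=
  Nat.dvd_antisymm (isPeriodicPt_iff_minimalPeriod_dvd.1 ((H n).2 dvd_rfl))
    ((H _).1 (isPeriodicPt_minimalPeriod h v))

theorem eq_attractingCycle {α : Type*} [Finite α] {h : α → α} {N : ℕ} (hN : 0 < N) {U : Set α}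
    {m₀ : ℕ} (hU : ∀ m ≥ m₀, Set.range h^[m] = U) (hc : ActsAsCycle h U N) :
    U = attractingCycle h N := by
  classical
  obtain ⟨hcard, hb, hcyc⟩ := hc
  have : Fintype U := Fintype.ofFinite U
  set e : Equiv.Perm U := Set.BijOn.equiv h hb
  have he : ∀ (n : ℕ) (a : U), (((e ^ n) a : U) : α) = h^[n] a := by
    intro n a
    induction n with
    | zero => rfl
    | succ n ih =>
      rw [pow_succ', Equiv.Perm.mul_apply, iterate_succ_apply', ← ih]
      rfl
  have hcyc' : e.IsCycleOn (↑(Finset.univ : Finset U) : Set U) := by simpa using hcyc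
  have hcard' : (Finset.univ : Finset U).card = N := by
    rw [Finset.card_univ, ← Nat.card_eq_fintype_card, Nat.card_coe_set_eq, hcard]
  ext v
  constructor
  · intro hv
    refine ⟨minimalPeriod_eq_of_forall_dvd fun t => ?_, fun u => ?_⟩
    · have := hcyc'.pow_apply_eq (Finset.mem_univ ⟨v, hv⟩) (n := t)
      rw [hcard'] at this
      rw [← this, Subtype.ext_iff, he]
      rfl
    · have hu : h^[m₀] u ∈ U := by
        rw [← hU m₀ le_rfl]
        exact ⟨u, rfl⟩
      obtain ⟨n, -, hn⟩ := hcyc'.exists_pow_eq (Finset.mem_univ ⟨_, hu⟩)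
        (Finset.mem_univ ⟨v, hv⟩)
      refine ⟨n + m₀, ?_⟩
      rw [iterate_add_apply]
      rw [Subtype.ext_iff, he] at hn
      exact hn
  · rintro ⟨hv, -⟩
    -- The exponent is at least `m₀`, and it is a multiple of the period, so `v` is its own
    -- preimage.
    rw [← hU (N * m₀) (Nat.le_mul_of_pos_left _ hN)]
    refine ⟨v, ?_⟩
    have := (isPeriodicPt_minimalPeriod h v).mul_const m₀
    rwa [hv] at this

/-- The stable image is the orbit of `v`. -/
theorem exists_actsAsCycle {α : Type*} [Finite α] {h : α → α} {N : ℕ} (hN : 0 < N) {v : α}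
    (hv : v ∈ attractingCycle h N) :
    ∃ U : Set α, (∃ m₀, ∀ m ≥ m₀, Set.range h^[m] = U) ∧ ActsAsCycle h U N := by
  classical
  have := Fintype.ofFinite α
  obtain ⟨hp, hr⟩ := hv
  have hper : IsPeriodicPt h N v := hp ▸ isPeriodicPt_minimalPeriod h v
  have hper' : ∀ a t, h^[N * a + t] v = h^[t] v := fun a t => by
    rw [add_comm, iterate_add_apply, (hper.mul_const a).eq]
  set U : Set α := Set.range fun t => h^[t] v
  have hmaps : Set.MapsTo h U U := by
    rintro _ ⟨t, rfl⟩
    exact ⟨t + 1, iterate_succ_apply' h t v⟩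
  have hbij : Set.BijOn h U U := by
    refine ⟨hmaps, ?_, ?_⟩
    · refine Set.LeftInvOn.injOn (f₁' := h^[N - 1]) ?_
      rintro _ ⟨t, rfl⟩
      simp only
      rw [← iterate_succ_apply' h t v, ← iterate_add_apply,
        show N - 1 + (t + 1) = N * 1 + t by omega, hper']
    · rintro _ ⟨t, rfl⟩
      refine ⟨h^[N - 1 + t] v, ⟨_, rfl⟩, ?_⟩
      rw [← iterate_succ_apply' h, show (N - 1 + t).succ = N * 1 + t by omega, hper']
  refine ⟨U, ?_, ?_, hbij, ?_⟩
  · choose m hm using hr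
    -- By finiteness, the sum bounds all the times `m u` at which `v` is reached, so all later
    -- images lie in the orbit.
    refine ⟨∑ u, m u, fun n hn => Set.Subset.antisymm ?_ ?_⟩
    · rintro _ ⟨u, rfl⟩
      refine ⟨n - m u, ?_⟩
      have hle : m u ≤ n := (Finset.single_le_sum (fun _ _ => Nat.zero_le _)
        (Finset.mem_univ u)).trans hn
      simp only
      rw [← hm u, ← iterate_add_apply, Nat.sub_add_cancel hle]
    · rintro _ ⟨t, rfl⟩
      refine ⟨h^[(N - 1) * n + t] v, ?_⟩
      simp only
      rw [← iterate_add_apply, ← hper' n t]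
      congr 1
      obtain ⟨N, rfl⟩ := Nat.exists_eq_succ_of_ne_zero hN.ne'
      simp only [Nat.succ_sub_one, Nat.succ_eq_add_one]
      ring_nf
  · have : U = (fun t => h^[t] v) '' Set.Iio N := by
      refine Set.Subset.antisymm ?_ (Set.image_subset_range _ _)
      rintro _ ⟨t, rfl⟩
      exact ⟨t % N, Nat.mod_lt _ hN, hper.iterate_mod_apply t⟩
    rw [this, Set.InjOn.ncard_image]
    · rw [← Finset.coe_range, Set.ncard_coe_finset, Finset.card_range]
    · have := iterate_injOn_Iio_minimalPeriod (f := h) (x := v)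
      rwa [hp] at this
  · set e : Equiv.Perm U := Set.BijOn.equiv h hbij
    refine ⟨e.bijective.bijOn_univ, ?_⟩
    have key : ∀ t : ℕ, (e ^ t) ⟨v, 0, rfl⟩ = ⟨h^[t] v, t, rfl⟩ := by
      intro t
      induction t with
      | zero => rfl
      | succ t ih =>
        rw [pow_succ', Equiv.Perm.mul_apply, ih]
        exact Subtype.ext (iterate_succ_apply' h t v).symm
    have hsame : ∀ x : U, e.SameCycle ⟨v, 0, rfl⟩ x := by
      rintro ⟨_, t, rfl⟩
      exact ⟨t, by rw [zpow_natCast]; exact key t⟩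
    exact fun x _ y _ => (hsame x).symm.trans (hsame y)

variable {k : ℕ} {X : ZMod k → Type*}

theorem mk_roundTrip_iterate (f : ∀ i, X i → X (i + 1)) (m : ℕ) (x : X 1) :
    (⟨1, (roundTrip f)^[m] x⟩ : Σ i, X i) = (step f)^[k * m] ⟨1, x⟩ := by
  rw [iterate_mul]
  exact Semiconj.iterate_right (f := fun x => (⟨1, x⟩ : Σ i, X i)) (mk_roundTrip f) m x

theorem dvd_of_step_iterate_eq {f : ∀ i, X i → X (i + 1)} {m : ℕ} {x y : X 1}
    (h : (step f)^[m] ⟨1, x⟩ = ⟨1, y⟩) : k ∣ m := by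
  have := step_iterate_fst f m ⟨1, x⟩
  rw [h] at this
  simpa [ZMod.natCast_eq_zero_iff] using this

/-- Each step raises the index by one, so `X 1` is revisited only after multiples of `k` steps. -/
theorem minimalPeriod_step (f : ∀ i, X i → X (i + 1)) (hk : 0 < k) (x : X 1) :
    minimalPeriod (step f) ⟨1, x⟩ = k * minimalPeriod (roundTrip f) x := by
  refine minimalPeriod_eq_of_forall_dvd fun t => ?_
  have key : ∀ t, IsPeriodicPt (step f) (k * t) ⟨1, x⟩ ↔ minimalPeriod (roundTrip f) x ∣ t := by
    intro t
    rw [← isPeriodicPt_iff_minimalPeriod_dvd, IsPeriodicPt, IsFixedPt, ← mk_roundTrip_iterate]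
    simp [IsPeriodicPt, IsFixedPt]
  constructor
  · intro h
    obtain ⟨s, rfl⟩ := dvd_of_step_iterate_eq h
    exact Nat.mul_dvd_mul_left k ((key s).1 h)
  · intro h
    obtain ⟨s, rfl⟩ := (Dvd.intro _ rfl).trans h
    exact (key s).2 (Nat.dvd_of_mul_dvd_mul_left hk h)

theorem mem_attractingCycle_roundTrip [NeZero k] {f : ∀ i, X i → X (i + 1)} {N : ℕ} {x : X 1} :
    x ∈ attractingCycle (roundTrip f) N ↔ ⟨1, x⟩ ∈ attractingCycle (step f) (k * N) := by
  have hk : 0 < k := Nat.pos_of_ne_zero (NeZero.ne k)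
  refine and_congr ?_ ⟨fun h u => ?_, fun h u => ?_⟩
  · rw [minimalPeriod_step f hk, Nat.mul_right_inj hk.ne']
  -- Every vertex enters `X 1` after `(1 - u.1).val` steps, and from there the round trip takes
  -- over.
  · have hu := step_iterate_fst f (1 - u.1).val u
    rw [ZMod.natCast_zmod_val, add_sub_cancel] at hu
    generalize hw : (step f)^[(1 - u.1).val] u = w at hu
    obtain ⟨i, w⟩ := w
    obtain rfl : i = 1 := hu
    obtain ⟨m, hm⟩ := h w
    refine ⟨k * m + (1 - u.1).val, ?_⟩
    rw [iterate_add_apply, hw, ← mk_roundTrip_iterate, hm]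
  · obtain ⟨m, hm⟩ := h ⟨1, u⟩
    obtain ⟨s, rfl⟩ := dvd_of_step_iterate_eq hm
    refine ⟨s, ?_⟩
    rw [← mk_roundTrip_iterate] at hm
    simpa using hm

open Classical in
theorem ncard_attractingCycle [Finite (X 1)] (f : ∀ i, X i → X (i + 1)) {N : ℕ} (hN : 0 < N) :
    (attractingCycle (roundTrip f) N).ncard = if EventuallyCyclic N f then N else 0 := by
  split_ifs with h
  · obtain ⟨U, ⟨m₀, hU⟩, hc⟩ := h
    rw [← eq_attractingCycle hN hU hc]
    exact hc.1
  · rw [Set.ncard_eq_zero, Set.eq_empty_iff_forall_notMem]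
    exact fun v hv => h (exists_actsAsCycle hN hv)

variable [NeZero k] {N : ℕ} [NeZero N]

/-- `b` enumerates the vertices of a cycle of `f` in the order in which they are visited, starting
from `b 1 0`, and the cycle attracts every vertex. -/
def EnumeratesCycle (f : ∀ i, X i → X (i + 1)) (b : ∀ i, Fin N ↪ X i) : Prop :=
  (∀ i j, f i (b i j) = b (i + 1) (if i = 0 then j + 1 else j)) ∧
    ∀ u, ∃ m i j, (step f)^[m] u = ⟨i, b i j⟩

/-- The position after `t` steps from the starting position `(1, 0)`. -/
def position (k N : ℕ) [NeZero N] (t : ℕ) : ZMod k × Fin N :=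
  (1 + t, Fin.ofNat N (t / k))

/-- The number of steps after which the position `p` is reached. -/
def positionTime (p : ZMod k × Fin N) : ℕ :=
  (p.1 - 1).val + k * p.2

-- The second coordinate counts completed rounds. It grows on leaving index 0, that is, `X k`,
-- because time starts at index 1.
omit [NeZero k] in
theorem position_succ (t : ℕ) : position k N (t + 1) = ((position k N t).1 + 1,
    if (position k N t).1 = 0 then (position k N t).2 + 1 else (position k N t).2) := by
  have hd : (1 + t : ZMod k) = 0 ↔ k ∣ t + 1 := by
    rw [← ZMod.natCast_eq_zero_iff]
    push_cast
    rw [add_comm]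
  refine Prod.ext ?_ ?_
  · simp [position, add_assoc]
  · simp only [position, hd, Nat.succ_div]
    split_ifs
    · simp [Fin.ext_iff, Fin.val_add]
    · rfl

omit [NeZero k] in
theorem positionTime_position (t : ℕ) : positionTime (position k N t) = t % (k * N) := by
  simp [positionTime, position, Nat.mod_mul, ZMod.val_natCast]

theorem position_positionTime (p : ZMod k × Fin N) : position k N (positionTime p) = p := by
  have hk : 0 < k := Nat.pos_of_ne_zero (NeZero.ne k)
  refine Prod.ext ?_ ?_
  · simp [positionTime, position]
  · simp only [positionTime, position]
    rw [Nat.add_mul_div_left _ _ hk, Nat.div_eq_of_lt (ZMod.val_lt _)]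
    simp

theorem positionTime_lt (p : ZMod k × Fin N) : positionTime p < k * N := by
  rw [← position_positionTime p, positionTime_position]
  exact Nat.mod_lt _ (Nat.mul_pos (Nat.pos_of_ne_zero (NeZero.ne k))
    (Nat.pos_of_ne_zero (NeZero.ne N)))

omit [NeZero k] in
theorem position_zero : position k N 0 = (1, 0) := by
  simp [position]

omit [NeZero k] in
theorem EnumeratesCycle.step_iterate {f : ∀ i, X i → X (i + 1)} {b : ∀ i, Fin N ↪ X i}
    (h : EnumeratesCycle f b) (t : ℕ) : (step f)^[t] ⟨1, b 1 0⟩ =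
      ⟨(position k N t).1, b (position k N t).1 (position k N t).2⟩ := by
  induction t with
  | zero => rw [position_zero]; rfl
  | succ t ih =>
    rw [iterate_succ_apply', ih, position_succ, step, h.1]

omit [NeZero k] [NeZero N] in
theorem mk_enum_injective (b : ∀ i, Fin N ↪ X i) :
    Injective fun p : ZMod k × Fin N => (⟨p.1, b p.1 p.2⟩ : Σ i, X i) := by
  rintro ⟨i, j⟩ ⟨i', j'⟩ h
  obtain rfl : i = i' := congrArg Sigma.fst h
  simpa using h

theorem EnumeratesCycle.mem_attractingCycle {f : ∀ i, X i → X (i + 1)} {b : ∀ i, Fin N ↪ X i}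
    (h : EnumeratesCycle f b) : b 1 0 ∈ attractingCycle (roundTrip f) N := by
  have hper : ∀ t, IsPeriodicPt (step f) t ⟨1, b 1 0⟩ ↔ k * N ∣ t := by
    intro t
    rw [IsPeriodicPt, IsFixedPt, h.step_iterate]
    have h1 : (⟨1, b 1 0⟩ : Σ i, X i) =
      ⟨(position k N 0).1, b (position k N 0).1 (position k N 0).2⟩ := h.step_iterate 0
    rw [h1, (mk_enum_injective b).eq_iff (a := position k N t), Nat.dvd_iff_mod_eq_zero,
      ← positionTime_position]
    constructor
    · intro e
      rw [e, positionTime_position, Nat.zero_mod]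
    · intro e
      rw [← position_positionTime (position k N t), e]
  rw [mem_attractingCycle_roundTrip]
  refine ⟨minimalPeriod_eq_of_forall_dvd hper, fun u => ?_⟩
  obtain ⟨m, i, j, hm⟩ := h.2 u
  have ht := h.step_iterate (positionTime (i, j))
  rw [position_positionTime] at ht
  refine ⟨(k * N - positionTime (i, j)) + m, ?_⟩
  rw [iterate_add_apply, hm, ← ht, ← iterate_add_apply,
    Nat.sub_add_cancel (positionTime_lt (i, j)).le]
  exact (hper _).2 dvd_rfl

theorem EnumeratesCycle.ext {f : ∀ i, X i → X (i + 1)} {b b' : ∀ i, Fin N ↪ X i}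
    (h : EnumeratesCycle f b) (h' : EnumeratesCycle f b') (h0 : b 1 0 = b' 1 0) : b = b' := by
  funext i
  ext j
  have h1 := h.step_iterate (positionTime (i, j))
  rw [h0, h'.step_iterate, position_positionTime] at h1
  simpa using h1.symm

theorem exists_enumeratesCycle {f : ∀ i, X i → X (i + 1)} {v : X 1}
    (hv : v ∈ attractingCycle (roundTrip f) N) :
    ∃ b : ∀ i, Fin N ↪ X i, EnumeratesCycle f b ∧ b 1 0 = v := by
  rw [mem_attractingCycle_roundTrip] at hv
  obtain ⟨hp, hr⟩ := hv
  have hper : IsPeriodicPt (step f) (k * N) ⟨1, v⟩ := hp ▸ isPeriodicPt_minimalPeriod _ _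
  -- The vertex at position `(i, j)` is the one that `v` reaches after `positionTime (i, j)` steps.
  have hex : ∀ i (j : Fin N), ∃ y : X i, ⟨i, y⟩ = (step f)^[positionTime (i, j)] ⟨1, v⟩ := by
    intro i j
    have h1 := step_iterate_fst f (positionTime (i, j)) ⟨1, v⟩
    have h2 : (1 + (positionTime (i, j) : ℕ) : ZMod k) = i :=
      congrArg Prod.fst (position_positionTime (i, j))
    rw [h2] at h1
    generalize (step f)^[positionTime (i, j)] ⟨1, v⟩ = w at h1
    obtain ⟨i', y⟩ := w
    obtain rfl : i' = i := h1
    exact ⟨y, rfl⟩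
  choose b hb using hex
  have hinj : ∀ i, Injective (b i) := by
    intro i j j' h
    have h1 : (step f)^[positionTime (i, j)] ⟨1, v⟩ = (step f)^[positionTime (i, j')] ⟨1, v⟩ := by
      rw [← hb, ← hb, h]
    rw [iterate_eq_iterate_iff_of_lt_minimalPeriod (hp.symm ▸ positionTime_lt _)
      (hp.symm ▸ positionTime_lt _)] at h1
    have h2 := congrArg (position k N) h1
    rw [position_positionTime, position_positionTime] at h2
    exact congrArg Prod.snd h2
  have hpos : ∀ t, (step f)^[t] ⟨1, v⟩ =
      ⟨(position k N t).1, b (position k N t).1 (position k N t).2⟩ := fun t => by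
    rw [hb, Prod.mk.eta, positionTime_position, hper.iterate_mod_apply]
  refine ⟨fun i => ⟨b i, hinj i⟩, ⟨fun i j => ?_, fun u => ?_⟩, ?_⟩
  · have h1 : step f ⟨i, b i j⟩ = (step f)^[positionTime (i, j) + 1] ⟨1, v⟩ := by
      rw [hb, iterate_succ_apply']
    rw [hpos, position_succ, position_positionTime, step] at h1
    simpa using h1
  · obtain ⟨m, hm⟩ := hr u
    refine ⟨m, 1, 0, ?_⟩
    have := hpos 0
    rw [position_zero] at this
    exact hm.trans this
  · have := hpos 0
    rw [position_zero] at this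
    simpa using this.symm

-- An enumeration is determined by its start `b 1 0`, which can be any of the `N` points of the
-- attracting cycle in `X 1`. This is the source of the denominator `N`.
open Classical in
theorem card_enumeratesCycle [∀ i, Fintype (X i)] (f : ∀ i, X i → X (i + 1)) :
    ({b : ∀ i, Fin N ↪ X i | EnumeratesCycle f b} : Finset _).card =
      if EventuallyCyclic N f then N else 0 := by
  rw [← ncard_attractingCycle f (Nat.pos_of_ne_zero (NeZero.ne N)), ← Set.ncard_coe_finset]
  refine Set.ncard_congr (fun b _ => b 1 0) ?_ ?_ ?_
  · intro b hb
    simp only [Finset.coe_filter, Finset.mem_univ, true_and, Set.mem_ofPred_eq] at hb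
    exact hb.mem_attractingCycle
  · intro b b' hb hb' h
    simp only [Finset.coe_filter, Finset.mem_univ, true_and, Set.mem_ofPred_eq] at hb hb'
    exact hb.ext hb' h
  · intro v hv
    obtain ⟨b, hb, h⟩ := exists_enumeratesCycle hv
    exact ⟨b, by simpa using hb, h⟩

end Starts

/-! ### Sums over injections and elementary symmetric polynomials -/

section EmbeddingSums

open Finset

variable {α R : Type*} [Fintype α] [CommRing R]

theorem card_filter_map_univ_eq [DecidableEq α] {n : ℕ} {t : Finset α} (ht : #t = n) :
    #{b : Fin n ↪ α | univ.map b = t} = n.factorial := by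
  have h : ({b : Fin n ↪ α | univ.map b = t} : Finset _) =
      (univ : Finset (Fin n ↪ t)).image fun b => b.trans (Function.Embedding.subtype _) := by
    ext b
    simp only [mem_filter, mem_univ, true_and, mem_image]
    constructor
    · intro hb
      exact ⟨⟨fun j => ⟨b j, hb ▸ mem_map_of_mem b (mem_univ j)⟩,
        fun i j hij => b.injective (congrArg Subtype.val hij)⟩, rfl⟩
    · rintro ⟨b, rfl⟩
      refine eq_of_subset_of_card_le ?_ (by simp [ht])
      intro v hv
      obtain ⟨j, -, rfl⟩ := mem_map.1 hv
      exact (b j).2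
  rw [h, card_image_of_injective, card_univ, Fintype.card_embedding_eq, Fintype.card_fin,
    Fintype.card_coe, ht, Nat.descFactorial_self]
  intro b b' hb
  ext j
  exact DFunLike.congr_fun hb j

theorem sum_embedding_prod (y : α → R) (n : ℕ) :
    ∑ b : Fin n ↪ α, ∏ j, y (b j) =
      n.factorial * ∑ t ∈ powersetCard n (univ : Finset α), ∏ v ∈ t, y v := by
  classical
  rw [← sum_fiberwise_of_maps_to (s := (univ : Finset (Fin n ↪ α)))
    (t := powersetCard n (univ : Finset α)) (g := fun b => univ.map b)
    (fun b _ => by simp [mem_powersetCard]), mul_sum]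
  refine sum_congr rfl fun t ht => ?_
  rw [← card_filter_map_univ_eq (mem_powersetCard.1 ht).2, ← nsmul_eq_mul, ← sum_const]
  refine sum_congr rfl fun b hb => ?_
  rw [← (mem_filter.1 hb).2, prod_map]

-- A point outside the range of an injection is precisely what extends it by one value.
open Classical in
theorem sum_embedding_prod_mul_sum (y : α → R) (n : ℕ) :
    ∑ b : Fin n ↪ α, (∏ j, y (b j)) * ∑ v with v ∉ Set.range b, y v =
      ∑ b : Fin (n + 1) ↪ α, ∏ j, y (b j) := by
  rw [← (Equiv.embeddingFinSucc n α).symm.sum_comp, Fintype.sum_sigma]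
  refine sum_congr rfl fun b _ => ?_
  rw [← sum_subtype_eq_sum_filter, mul_sum]
  refine sum_bij' (fun v _ => ⟨v, by simpa using v.2⟩) (fun v _ => ⟨v, by simpa using v.2⟩)
    ?_ ?_ ?_ ?_ ?_
  all_goals simp [Fin.prod_univ_succ, mul_comm]

end EmbeddingSums

/-! ### Cycle plus forest, and summation over the cycles -/

section Assembly

open Finset

variable {k : ℕ} {X : ZMod k → Type*} {N : ℕ} {R : Type*}

/-- The position that follows `p` on the cycle. -/
def nextPosition [NeZero N] (p : ZMod k × Fin N) : ZMod k × Fin N :=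
  (p.1 + 1, if p.1 = 0 then p.2 + 1 else p.2)

theorem nextPosition_injective [NeZero N] :
    Function.Injective (nextPosition : ZMod k × Fin N → _) := by
  rintro ⟨i, j⟩ ⟨i', j'⟩ h
  simp only [nextPosition, Prod.mk.injEq, add_left_inj] at h
  obtain ⟨rfl, h⟩ := h
  split_ifs at h
  · rw [add_left_inj] at h
    rw [h]
  · rw [h]

variable [NeZero k] [∀ i, Fintype (X i)]

open Classical in
/-- The vertices enumerated by `b`. -/
noncomputable def cycleSet (b : ∀ i, Fin N ↪ X i) : Finset (Σ i, X i) :=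
  univ.image fun p : ZMod k × Fin N => ⟨p.1, b p.1 p.2⟩

omit [∀ i, Fintype (X i)] in
theorem mem_cycleSet {b : ∀ i, Fin N ↪ X i} {i : ZMod k} {v : X i} :
    (⟨i, v⟩ : Σ i, X i) ∈ cycleSet b ↔ v ∈ Set.range (b i) := by
  simp only [cycleSet, mem_image, mem_univ, true_and, Set.mem_range, Prod.exists]
  constructor
  · rintro ⟨i', j, h⟩
    obtain rfl : i' = i := congrArg Sigma.fst h
    exact ⟨j, by simpa using h⟩
  · rintro ⟨j, rfl⟩
    exact ⟨i, j, rfl⟩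

omit [∀ i, Fintype (X i)] in
theorem mk_mem_cycleSet (b : ∀ i, Fin N ↪ X i) (p : ZMod k × Fin N) :
    (⟨p.1, b p.1 p.2⟩ : Σ i, X i) ∈ cycleSet b :=
  mem_cycleSet.2 ⟨_, rfl⟩

omit [∀ i, Fintype (X i)] in
theorem exists_eq_of_mem_cycleSet {b : ∀ i, Fin N ↪ X i} {u : Σ i, X i} (hu : u ∈ cycleSet b) :
    ∃ p : ZMod k × Fin N, u = ⟨p.1, b p.1 p.2⟩ := by
  classical
  obtain ⟨p, -, h⟩ := mem_image.1 hu
  exact ⟨p, h.symm⟩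

omit [∀ i, Fintype (X i)] in
theorem enumeratesCycle_iff [NeZero N] {f : ∀ i, X i → X (i + 1)} {b : ∀ i, Fin N ↪ X i} :
    EnumeratesCycle f b ↔
      (∀ p : ZMod k × Fin N, step f ⟨p.1, b p.1 p.2⟩ =
        ⟨(nextPosition p).1, b (nextPosition p).1 (nextPosition p).2⟩) ∧
      ∀ u, ∃ m, (step f)^[m] u ∈ cycleSet b := by
  refine and_congr ?_ (forall_congr' fun u => exists_congr fun m => ?_)
  · refine ⟨fun h p => Sigma.ext rfl (heq_of_eq (h p.1 p.2)), fun h i j => ?_⟩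
    exact eq_of_heq (Sigma.mk.inj (h (i, j))).2
  · constructor
    · rintro ⟨i, j, h⟩
      exact h ▸ mk_mem_cycleSet b (i, j)
    · intro h
      obtain ⟨p, h⟩ := exists_eq_of_mem_cycleSet h
      exact ⟨p.1, p.2, h⟩

variable [CommRing R]

-- The tuple is determined by `b` on the cycle and by a forest off it. Following the cycle permutes
-- its vertices, so its edges contribute each cycle vertex once.
open Classical in
theorem sum_enumeratesCycle [NeZero N] (x : (Σ i, X i) → R) (b : ∀ i, Fin N ↪ X i) :
    ∑ f : ∀ i, X i → X (i + 1) with EnumeratesCycle f b, ∏ i, ∏ v, x ⟨i + 1, f i v⟩ =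
      (∏ i, ∏ j, x ⟨i, b i j⟩) * forestSum x Sigma.fst (cycleSet b)ᶜ (cycleSet b) := by
  rw [forestSum, mul_sum]
  set U := cycleSet b with hU
  -- Whether every orbit meets `U` depends only on the values off `U`, since only the steps before
  -- the first visit matter.
  have hg : ∀ {h g : (Σ i, X i) → Σ i, X i}, (∀ u ∉ U, h u = g u) →
      (∀ u, ∃ m, h^[m] u ∈ U) → ∀ u, ∃ m, g^[m] u ∈ U := by
    intro h g hgh H u
    obtain ⟨m, hm⟩ := H u
    induction m generalizing u with
    | zero => exact ⟨0, hm⟩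
    | succ m ih =>
      by_cases hu : u ∈ U
      · exact ⟨0, hu⟩
      · rw [Function.iterate_succ_apply, hgh u hu] at hm
        obtain ⟨m', h'⟩ := ih _ hm
        exact ⟨m' + 1, h'⟩
  refine sum_bij (fun f _ u => if u ∈ U then u else step f u) ?_ ?_ ?_ ?_
  · intro f hf
    rw [mem_filter, enumeratesCycle_iff] at hf
    simp only [mem_forests, mem_raisingMaps, mem_compl, not_not]
    refine ⟨⟨fun u hu => if_pos hu, fun u hu => ⟨?_, ?_⟩⟩, ?_⟩
    · rw [union_comm, union_compl]
      exact mem_univ _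
    · rw [if_neg hu]
      rfl
    · exact hg (fun u hu => (if_neg hu).symm) hf.2.2
  · intro f hf f' hf' h
    rw [mem_filter, enumeratesCycle_iff] at hf hf'
    funext i v
    have hstep : step f ⟨i, v⟩ = step f' ⟨i, v⟩ := by
      by_cases hv : (⟨i, v⟩ : Σ i, X i) ∈ U
      · obtain ⟨p, hp⟩ := exists_eq_of_mem_cycleSet hv
        rw [hp, hf.2.1, hf'.2.1]
      · simpa [hv] using congrFun h ⟨i, v⟩
    simpa [step] using hstep
  · intro g hgf
    simp only [mem_forests, mem_raisingMaps, mem_compl, not_not] at hgf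
    obtain ⟨⟨h1, h2⟩, h3⟩ := hgf
    -- The value is forced by `b` on the cycle and taken from `g` elsewhere. Stating this in the
    -- sigma type avoids transport between fibers.
    have hex : ∀ i (v : X i), ∃ w : X (i + 1),
        ((⟨i, v⟩ : Σ i, X i) ∉ U → ⟨i + 1, w⟩ = g ⟨i, v⟩) ∧
        ∀ p : ZMod k × Fin N, (⟨i, v⟩ : Σ i, X i) = ⟨p.1, b p.1 p.2⟩ →
          (⟨i + 1, w⟩ : Σ i, X i) =
            ⟨(nextPosition p).1, b (nextPosition p).1 (nextPosition p).2⟩ := by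
      intro i v
      by_cases hv : (⟨i, v⟩ : Σ i, X i) ∈ U
      · obtain ⟨j, rfl⟩ := mem_cycleSet.1 hv
        refine ⟨b (i + 1) (nextPosition (i, j)).2, fun h => absurd hv h, fun p hp => ?_⟩
        have := mk_enum_injective b (a₁ := (i, j)) (a₂ := p) hp
        rw [← this]
        rfl
      · have h4 := (h2 _ hv).2
        generalize hw : g ⟨i, v⟩ = w at h4
        obtain ⟨i', w⟩ := w
        obtain rfl : i' = i + 1 := h4
        refine ⟨w, fun _ => rfl, fun p hp => absurd ?_ hv⟩
        rw [hp]
        exact mk_mem_cycleSet b p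
    choose f hf1 hf2 using hex
    refine ⟨f, ?_, ?_⟩
    · rw [mem_filter, enumeratesCycle_iff]
      exact ⟨mem_univ _, fun p => hf2 _ _ p rfl,
        hg (h := g) (fun u hu => (hf1 u.1 u.2 hu).symm) h3⟩
    · funext u
      split_ifs with hu
      · exact (h1 u hu).symm
      · exact hf1 u.1 u.2 hu
  · intro f hf
    rw [mem_filter, enumeratesCycle_iff] at hf
    have h1 : ∏ i, ∏ v, x ⟨i + 1, f i v⟩ = ∏ u, x (step f u) :=
      (Fintype.prod_sigma fun u => x (step f u)).symm
    rw [h1, ← prod_mul_prod_compl U]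
    congr 1
    · rw [hU, cycleSet, prod_image fun p _ q _ h => mk_enum_injective b h]
      simp_rw [hf.2.1]
      rw [(Finite.injective_iff_bijective.1 nextPosition_injective).prod_comp
        fun p : ZMod k × Fin N => x ⟨p.1, b p.1 p.2⟩, Fintype.prod_prod_type]
    · refine prod_congr rfl fun u hu => ?_
      simp only [if_neg (mem_compl.1 hu)]

open Classical in
theorem natCast_mul_sum_eventuallyCyclic [NeZero N] (x : (Σ i, X i) → R) :
    (N : R) * ∑ f : ∀ i, X i → X (i + 1) with EventuallyCyclic N f,
        ∏ i, ∏ v, x ⟨i + 1, f i v⟩ =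
      ∑ b : ∀ i, Fin N ↪ X i, (∏ i, ∏ j, x ⟨i, b i j⟩) *
        forestSum x Sigma.fst (cycleSet b)ᶜ (cycleSet b) := by
  simp_rw [← sum_enumeratesCycle, sum_filter]
  rw [sum_comm, mul_sum]
  refine sum_congr rfl fun f _ => ?_
  rw [← sum_filter, sum_const, card_enumeratesCycle, nsmul_eq_mul]
  split_ifs <;> simp

omit [NeZero k] in
open Classical in
theorem filter_fst_eq (S : Finset (Σ i, X i)) (i : ZMod k) :
    ({u ∈ S | u.1 = i} : Finset _) =
      ({v : X i | ⟨i, v⟩ ∈ S} : Finset _).map (Function.Embedding.sigmaMk i) := by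
  ext ⟨i', v⟩
  simp only [mem_filter, mem_map, mem_univ, true_and]
  constructor
  · rintro ⟨h, rfl⟩
    exact ⟨v, h, rfl⟩
  · rintro ⟨w, hw, h⟩
    obtain rfl : i = i' := congrArg Sigma.fst h
    rw [← h]
    exact ⟨hw, rfl⟩

open Classical in
theorem classSum_fst_univ (x : (Σ i, X i) → R) (i : ZMod k) :
    classSum x Sigma.fst univ i = ∑ v, x ⟨i, v⟩ := by
  simp [classSum, filter_fst_eq]

open Classical in
theorem classSum_fst_cycleSet_compl (x : (Σ i, X i) → R) (b : ∀ i, Fin N ↪ X i) (i : ZMod k) :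
    classSum x Sigma.fst (cycleSet b)ᶜ i = ∑ v with v ∉ Set.range (b i), x ⟨i, v⟩ := by
  rw [classSum, filter_fst_eq, sum_map]
  simp only [mem_compl, mem_cycleSet]
  rfl

open Classical in
theorem card_cycleSet_compl (b : ∀ i, Fin N ↪ X i) (i : ZMod k) :
    #{u ∈ (cycleSet b)ᶜ | u.1 = i} = Fintype.card (X i) - N := by
  rw [filter_fst_eq, card_map]
  have : ({v : X i | (⟨i, v⟩ : Σ i, X i) ∈ (cycleSet b)ᶜ} : Finset _) =
      (univ.map (b i))ᶜ := by
    ext v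
    simp [mem_cycleSet]
  rw [this, card_compl, card_map, card_univ, Fintype.card_fin]

open Classical in
theorem forestSum_cycleSet {K : Type*} [Field K] (x : (Σ i, X i) → K)
    (hx : ∀ i, ∑ v, x ⟨i, v⟩ ≠ 0) (b : ∀ i, Fin N ↪ X i) :
    forestSum x Sigma.fst (cycleSet b)ᶜ (cycleSet b) =
      (∏ i, (∑ v, x ⟨i, v⟩) ^ ((Fintype.card (X (i - 1)) : ℤ) - (N + 1))) *
        (∏ i, ∑ v, x ⟨i, v⟩ - ∏ i, ∑ v with v ∉ Set.range (b i), x ⟨i, v⟩) := by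
  rw [forestSum_eq x Sigma.fst disjoint_compl_left, union_comm, union_compl]
  simp_rw [classSum_fst_univ, card_cycleSet_compl, classSum_fst_cycleSet_compl]
  have hle : ∀ i, N ≤ Fintype.card (X i) := fun i => by
    simpa using Fintype.card_le_of_embedding (b i)
  -- Forest exponents count the sources in class `i`, whose images lie in class `i + 1`; the theorem
  -- indexes by the target.
  have hshift : ∏ i, (∑ v, x ⟨i, v⟩) ^ ((Fintype.card (X (i - 1)) : ℤ) - (N + 1)) =
      ∏ i, (∑ v, x ⟨i + 1, v⟩) ^ ((Fintype.card (X i) : ℤ) - (N + 1)) := by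
    rw [← Equiv.prod_comp (Equiv.addRight (1 : ZMod k))]
    refine prod_congr rfl fun i _ => ?_
    have h : ∀ j, j = i → Fintype.card (X j) = Fintype.card (X i) := by
      rintro _ rfl
      rfl
    rw [Equiv.coe_addRight, h _ (add_sub_cancel_right i 1)]
  rw [hshift, mul_sub]
  congr 1
  · rw [← Equiv.prod_comp (Equiv.addRight (1 : ZMod k)) (fun i => ∑ v, x ⟨i, v⟩),
      ← prod_mul_distrib]
    refine prod_congr rfl fun i _ => ?_
    rw [Equiv.coe_addRight, ← zpow_add_one₀ (hx _), ← zpow_natCast]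
    congr 1
    have := hle i
    omega
  · rw [mul_comm]
    -- The natural exponent `card - N - 1` is truncated only if the cycle exhausts some class; then
    -- the sum over the vertices off the cycle in that class is zero.
    by_cases hlt : ∀ i, N < Fintype.card (X i)
    · congr 1
      refine prod_congr rfl fun i _ => ?_
      rw [← zpow_natCast]
      congr 1
      have := hlt i
      omega
    · push Not at hlt
      obtain ⟨i, hi⟩ := hlt
      have hsurj : Function.Surjective (b i) :=
        ((Fintype.bijective_iff_injective_and_card _).2
          ⟨(b i).injective, by simpa using (hle i).antisymm hi⟩).2
      have h0 : ∏ i, ∑ v with v ∉ Set.range (b i), x ⟨i, v⟩ = 0 :=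
        prod_eq_zero (mem_univ i) (sum_eq_zero fun v hv =>
          absurd (hsurj v) (mem_filter.1 hv).2)
      rw [h0, mul_zero, mul_zero]

/-- The count of eventually `N`-cyclic tuples with arbitrary weights in a field. -/
theorem natCast_mul_sum_eventuallyCyclic_eq {K : Type*} [Field K] [NeZero N]
    (x : (Σ i, X i) → K) (hx : ∀ i, ∑ v, x ⟨i, v⟩ ≠ 0) :
    (N : K) * (open Classical in ∑ f : ∀ i, X i → X (i + 1) with EventuallyCyclic N f,
        ∏ i, ∏ v, x ⟨i + 1, f i v⟩) =
      (N.factorial : K) ^ k *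
        (∏ i, (∑ v, x ⟨i, v⟩) ^ ((Fintype.card (X (i - 1)) : ℤ) - (N + 1))) *
        (∏ i, ((∑ v, x ⟨i, v⟩) * ∑ t ∈ powersetCard N univ, ∏ v ∈ t, x ⟨i, v⟩) -
          (N + 1) ^ k * ∏ i, ∑ t ∈ powersetCard (N + 1) univ, ∏ v ∈ t, x ⟨i, v⟩) := by
  classical
  have h1 : ∑ b : ∀ i, Fin N ↪ X i, ∏ i, ∏ j, x ⟨i, b i j⟩ =
      (N.factorial : K) ^ k * ∏ i, ∑ t ∈ powersetCard N univ, ∏ v ∈ t, x ⟨i, v⟩ := by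
    rw [← Fintype.piFinset_univ, ← prod_univ_sum (fun _ => univ) fun i (b : Fin N ↪ X i) =>
      ∏ j, x ⟨i, b j⟩]
    simp_rw [fun i => sum_embedding_prod (fun v : X i => x ⟨i, v⟩) N]
    rw [prod_mul_distrib, prod_const, card_univ, ZMod.card]
  have h2 : ∑ b : ∀ i, Fin N ↪ X i, (∏ i, ∏ j, x ⟨i, b i j⟩) *
        ∏ i, ∑ v with v ∉ Set.range (b i), x ⟨i, v⟩ =
      (N.factorial : K) ^ k * ((N + 1) ^ k *
        ∏ i, ∑ t ∈ powersetCard (N + 1) univ, ∏ v ∈ t, x ⟨i, v⟩) := by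
    simp_rw [← prod_mul_distrib]
    rw [← Fintype.piFinset_univ, ← prod_univ_sum (fun _ => univ) fun i (b : Fin N ↪ X i) =>
      (∏ j, x ⟨i, b j⟩) * ∑ v with v ∉ Set.range b, x ⟨i, v⟩]
    simp_rw [fun i => sum_embedding_prod_mul_sum (fun v : X i => x ⟨i, v⟩) N,
      fun i => sum_embedding_prod (fun v : X i => x ⟨i, v⟩) (N + 1)]
    rw [prod_mul_distrib, prod_const, card_univ, ZMod.card, Nat.factorial_succ, ← mul_assoc,
      ← mul_pow]
    push_cast
    rw [mul_comm (N.factorial : K)]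
  rw [natCast_mul_sum_eventuallyCyclic, sum_congr rfl fun b _ => by
    rw [forestSum_cycleSet x hx b, mul_left_comm, mul_sub], ← mul_sum, sum_sub_distrib, h2,
    ← sum_mul, h1, prod_mul_distrib]
  ring

end Assembly

end CyclicTuples

/-! ### The formula in the field of fractions -/

theorem theorem4p4 (k N : ℕ) [NeZero k] (hN : 0 < N)
    (X : ZMod k → Type*) [∀ i, Fintype (X i)] :
    let ι := algebraMap (MvPolynomial (Σ i, X i) ℤ) (FractionRing (MvPolynomial (Σ i, X i) ℤ))
    ι (CyclicTuples.genPoly X N) =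
      ((Nat.factorial N : FractionRing (MvPolynomial (Σ i, X i) ℤ)) ^ k / N) *
        (∏ i, ι (CyclicTuples.e X 1 i) ^ ((Fintype.card (X (i - 1)) : ℤ) - ((N : ℤ) + 1))) *
        ((∏ j, (ι (CyclicTuples.e X 1 j) * ι (CyclicTuples.e X N j))) -
          ((N : FractionRing (MvPolynomial (Σ i, X i) ℤ)) + 1) ^ k *
            ∏ j, ι (CyclicTuples.e X (N + 1) j)) := by
  classical
  intro ι
  have : NeZero N := ⟨hN.ne'⟩
  set x : (Σ i, X i) → FractionRing (MvPolynomial (Σ i, X i) ℤ) :=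
    fun u => ι (MvPolynomial.X u) with hx
  have he : ∀ n i, ι (CyclicTuples.e X n i) =
      ∑ t ∈ Finset.powersetCard n Finset.univ, ∏ v ∈ t, x ⟨i, v⟩ := by
    intro n i
    simp [CyclicTuples.e, MvPolynomial.esymm, hx]
  have he1 : ∀ i, ι (CyclicTuples.e X 1 i) = ∑ v, x ⟨i, v⟩ := by
    intro i
    simp [he, Finset.powersetCard_one]
  by_cases hne : ∀ i, Nonempty (X i)
  · have hx0 : ∀ i, ∑ v, x ⟨i, v⟩ ≠ 0 := by
      intro i h
      rw [hx, ← map_sum, map_eq_zero_iff ι (IsFractionRing.injective _ _)] at h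
      -- Setting all variables to 1 turns the sum into the cardinality of `X i`, which is nonzero.
      have h1 := congrArg (MvPolynomial.eval fun _ => (1 : ℤ)) h
      simp at h1
    have key := CyclicTuples.natCast_mul_sum_eventuallyCyclic_eq (N := N) x hx0
    have hg : ι (CyclicTuples.genPoly X N) =
        ∑ f : ∀ i, X i → X (i + 1) with CyclicTuples.EventuallyCyclic N f,
          ∏ i, ∏ v, x ⟨i + 1, f i v⟩ := by
      simp [CyclicTuples.genPoly, CyclicTuples.weight, hx]
    have hN0 : (N : FractionRing (MvPolynomial (Σ i, X i) ℤ)) ≠ 0 := by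
      exact_mod_cast hN.ne'
    simp_rw [he1, he]
    rw [hg, eq_comm, div_mul_eq_mul_div, div_mul_eq_mul_div, div_eq_iff hN0, ← key, mul_comm]
  -- If some `X i` is empty, both products in the bracket vanish, so the value of the negative
  -- powers of zero is immaterial. No tuple counts, as an enumeration would embed `Fin N` into `X
  -- i`.
  · push Not at hne
    obtain ⟨i, hi⟩ := hne
    have hz : ∀ n, ι (CyclicTuples.e X (n + 1) i) = 0 := by
      intro n
      rw [he, Finset.powersetCard_eq_empty.2 (by simp), Finset.sum_empty]
    have hg : CyclicTuples.genPoly X N = 0 := by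
      rw [CyclicTuples.genPoly, Finset.filter_false_of_mem, Finset.sum_empty]
      rintro f - hf
      have hcard := CyclicTuples.card_enumeratesCycle (N := N) f
      rw [if_pos hf] at hcard
      obtain ⟨b, -⟩ := Finset.card_pos.1 (hcard ▸ hN)
      exact isEmptyElim (b i 0)
    have h1 : ∏ j, (ι (CyclicTuples.e X 1 j) * ι (CyclicTuples.e X N j)) = 0 :=
      Finset.prod_eq_zero (Finset.mem_univ i) (by rw [hz 0, zero_mul])
    have h2 : ∏ j, ι (CyclicTuples.e X (N + 1) j) = 0 :=
      Finset.prod_eq_zero (Finset.mem_univ i) (hz N)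
    rw [hg, h1, h2, map_zero, mul_zero, sub_zero, mul_zero]
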